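/- Let $p,q$ be primes with $q>2$ and $p\equiv 1\pmod q$, and let $g$ be an element of order $q$ in $\mathbb Z_p^\times$. For $a,b\in\mathbb Z_q$ let $\mathcal D_{a,b}=\mathrm{diag}(g^a,g^b)$, let $\mathbb Z_p^2\rtimes_{\mathcal D_{a,b}}\mathbb Z_q$ be the semidirect product in which $1\in\mathbb Z_q$ acts on $\mathbb Z_p^2$ by $\mathcal D_{a,b}$, and for $k\in\mathbb Z_q$ put $\mathcal G_k=\mathbb Z_p^2\rtimes_{\mathcal D_{1,k}}\mathbb Z_q$. A skew brace is a triple $(B,+,\circ)$ such that $(B,+)$ and $(B,\circ)$ are groups and $x\circ(y+z)=x\circ y-x+x\circ z$ for all $x,y,z\in B$; it is a bi-skew brace if $(B,\circ,+)$ is a skew brace as well; it is of $G$-type if $(B,+)\cong G$; and $\lambda:(B,\circ)\to\mathrm{Aut}(B,+)$ is the homomorphism $\lambda_x(y)=-x+x\circ y$. Let $k\in\mathbb Z_q$ with $k\neq\pm1$ (the case $k=0$ is included). For $(a,b)\in\mathbb Z_q^2$ with $(a,b)\neq(0,0)$, the set $\mathbb Z_p\times\mathbb Z_p\times\mathbb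 Z_q$ with the operations $$\begin{pmatrix}x_1\\x_2\\x_3\end{pmatrix}+\begin{pmatrix}y_1\\y_2\\y_3\end{pmatrix}=\begin{pmatrix}x_1+g^{x_3}y_1\\x_2+g^{kx_3}y_2\\x_3+y_3\end{pmatrix},\qquad \begin{pmatrix}x_1\\x_2\\x_3\end{pmatrix}\circ\begin{pmatrix}y_1\\y_2\\y_3\end{pmatrix}=\begin{pmatrix}x_1+g^{(a+1)x_3}y_1\\x_2+g^{(b+k)x_3}y_2\\x_3+y_3\end{pmatrix}$$ is a bi-skew brace $B_{a,b}$ of $\mathcal G_k$-type with $|\ker\lambda|=p^2$. In these coordinates $(B_{a,b},+)=\mathbb Z_p^2\rtimes_{\mathcal D_{1,k}}\mathbb Z_q=\mathcal G_k$ and $$(B_{a,b},\circ)=\mathbb Z_p^2\rtimes_{\mathcal D_{a+1,b+k}}\mathbb Z_q\cong\begin{cases}\mathbb Z_p^2\times\mathbb Z_q,&\text{if }a=-1,\ b=-k,\\ \mathcal G_0,&\text{if }a=-1,\ b\neq-k,\\ \mathcal G_{\frac{b+k}{a+1}},&\text{if }a\neq-1.\end{cases}$$ The skew braces $B_{a,b}$,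 $(a,b)\neq(0,0)$, are pairwise non-isomorphic, and every skew brace of $\mathcal G_k$-type with $|\ker\lambda|=p^2$ is isomorphic to one of them. In particular, there are exactly $q^2-1$ isomorphism classes of such skew braces, and all of them are bi-skew braces. -/

import Mathlib

universe u

/-- A skew (left) brace: a set with two (not necessarily commutative) group structures, the additive
one `(B, +)` and the multiplicative one `(B, ∘)` (written `*` here), such that
`a ∘ (b + c) = a ∘ b - a + a ∘ c`. -/
class SkewBrace (B : Type u) extends AddGroup B, Group B where
  mul_add_skew : ∀ a b c : B, a * (b + c) = a * b - a + a * c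

namespace SkewBrace

section Basic

variable (B : Type u) [SkewBrace B]

theorem mul_zero_skew (a : B) : a * 0 = a := by
  have h := SkewBrace.mul_add_skew a 0 0
  rw [add_zero, sub_eq_add_neg, add_assoc, left_eq_add] at h
  exact (neg_add_eq_zero.mp h).symm

/-- The map `λ_a : b ↦ -a + a ∘ b`, an automorphism of the additive group. -/
def lamAut (a : B) : AddAut B where
  toFun b := -a + a * b
  invFun b := a⁻¹ * (a + b)
  left_inv b := by simp
  right_inv b := by simp
  map_add' b c := by
    rw [SkewBrace.mul_add_skew, sub_eq_add_neg]
    simp only [add_assoc]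

/-- The homomorphism `λ : (B, ∘) → Aut (B, +)`, `λ_a (b) = -a + a ∘ b`. Mathlib writes the
composition of additive automorphisms as a sum, hence `Multiplicative`. -/
def lam : B →* Multiplicative (AddAut B) where
  toFun a := .ofAdd (lamAut B a)
  map_one' := by
    rw [← ofAdd_zero]
    congr 1
    ext b
    have h : (1 : B) = 0 := by
      have := mul_zero_skew B 1
      rwa [one_mul, eq_comm] at this
    change -(1 : B) + 1 * b = b
    rw [one_mul, h, neg_zero, zero_add]
  map_mul' a a' := by
    rw [← ofAdd_add]
    congr 1
    ext b
    change -(a * a') + a * a' * b = -a + a * (-a' + a' * b)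
    have h : a * (a' + (-a' + a' * b)) = a * a' - a + a * (-a' + a' * b) :=
      SkewBrace.mul_add_skew _ _ _
    rw [add_neg_cancel_left, ← mul_assoc] at h
    rw [h, sub_eq_add_neg]
    simp only [add_assoc, neg_add_cancel_left]

/-- `B` is a bi-skew brace: `(B, ∘, +)` is a skew brace as well. -/
def IsBiSkew : Prop :=
  ∀ x y z : B, x + y * z = (x + y) * x⁻¹ * (x + z)

/-- `B` is of `G`-type: its additive group is isomorphic to `G`. -/
def IsOfType (G : Type*) [Group G] : Prop :=
  Nonempty (Multiplicative B ≃* G)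

end Basic

section Groups

variable {p q : ℕ} [Fact q.Prime]

/-- `g ^ n` for `n` in `ℤ/q` (well defined as a homomorphism when `g` has order `q`). -/
def gpow (g : (ZMod p)ˣ) (n : ZMod q) : (ZMod p)ˣ := g ^ n.val

theorem gpow_zero (g : (ZMod p)ˣ) : gpow g (0 : ZMod q) = 1 := by
  simp [gpow]

theorem gpow_add (g : (ZMod p)ˣ) (hg : orderOf g = q) (m n : ZMod q) :
    gpow g (m + n) = gpow g m * gpow g n := by
  have h := pow_mod_orderOf g (m.val + n.val)
  rw [gpow, gpow, gpow, ← pow_add, ZMod.val_add, ← h]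
  simp only [hg]

/-- The automorphism of `(ℤ/p)²` with diagonal matrix `diag(u, v)`. -/
def diagAut (u v : (ZMod p)ˣ) : MulAut (Multiplicative (ZMod p × ZMod p)) where
  toFun x := .ofAdd ((u : ZMod p) * x.toAdd.1, (v : ZMod p) * x.toAdd.2)
  invFun x := .ofAdd (((u⁻¹ : (ZMod p)ˣ) : ZMod p) * x.toAdd.1,
    ((v⁻¹ : (ZMod p)ˣ) : ZMod p) * x.toAdd.2)
  left_inv x := by simp
  right_inv x := by simp
  map_mul' x y := by
    rw [← ofAdd_add]
    simp [mul_add]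

/-- The action of the cyclic group `ℤ/q` on `(ℤ/p)²` in which `1` acts by the diagonal matrix
`D_{a,b} = diag(g ^ a, g ^ b)`, so that `n` acts by `diag(g ^ (a n), g ^ (b n))`. -/
def diagAction (g : (ZMod p)ˣ) (hg : orderOf g = q) (a b : ZMod q) :
    Multiplicative (ZMod q) →* MulAut (Multiplicative (ZMod p × ZMod p)) where
  toFun n := diagAut (gpow g (a * n.toAdd)) (gpow g (b * n.toAdd))
  map_one' := by
    ext x <;> simp [diagAut, gpow_zero]
  map_mul' m n := by
    ext x <;> simp [diagAut, mul_add, gpow_add g hg, mul_assoc]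

/-- The semidirect product `(ℤ/p)² ⋊_{D_{a,b}} ℤ/q`. -/
abbrev DiagProd (g : (ZMod p)ˣ) (hg : orderOf g = q) (a b : ZMod q) : Type :=
  Multiplicative (ZMod p × ZMod p) ⋊[diagAction g hg a b] Multiplicative (ZMod q)

/-- The group `𝒢_k = (ℤ/p)² ⋊_{D_{1,k}} ℤ/q`. -/
abbrev GK (g : (ZMod p)ˣ) (hg : orderOf g = q) (k : ZMod q) : Type :=
  DiagProd g hg 1 k

/-- The underlying set `(ℤ/p)² × ℤ/q` of the skew brace `B_{a,b}` of `𝒢_k`-type. -/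
@[ext]
structure Bab (g : (ZMod p)ˣ) (hg : orderOf g = q) (k a b : ZMod q) : Type where
  x₁ : ZMod p
  x₂ : ZMod p
  x₃ : ZMod q

namespace Bab

variable (g : (ZMod p)ˣ) (hg : orderOf g = q) (k a b : ZMod q)

instance : Add (Bab g hg k a b) where
  add x y := ⟨x.x₁ + gpow g x.x₃ * y.x₁, x.x₂ + gpow g (k * x.x₃) * y.x₂, x.x₃ + y.x₃⟩

instance : Zero (Bab g hg k a b) where
  zero := ⟨0, 0, 0⟩

instance : Neg (Bab g hg k a b) where
  neg x := ⟨-(gpow g (-x.x₃) * x.x₁), -(gpow g (k * -x.x₃) * x.x₂), -x.x₃⟩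

instance : Mul (Bab g hg k a b) where
  mul x y := ⟨x.x₁ + gpow g ((a + 1) * x.x₃) * y.x₁, x.x₂ + gpow g ((b + k) * x.x₃) * y.x₂,
    x.x₃ + y.x₃⟩

instance : One (Bab g hg k a b) where
  one := ⟨0, 0, 0⟩

instance : Inv (Bab g hg k a b) where
  inv x := ⟨-(gpow g ((a + 1) * -x.x₃) * x.x₁), -(gpow g ((b + k) * -x.x₃) * x.x₂), -x.x₃⟩

variable {g hg k a b}

theorem add_def (x y : Bab g hg k a b) : x + y =
    ⟨x.x₁ + gpow g x.x₃ * y.x₁, x.x₂ + gpow g (k * x.x₃) * y.x₂, x.x₃ + y.x₃⟩ := rfl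

theorem zero_def : (0 : Bab g hg k a b) = ⟨0, 0, 0⟩ := rfl

theorem neg_def (x : Bab g hg k a b) : -x =
    ⟨-(gpow g (-x.x₃) * x.x₁), -(gpow g (k * -x.x₃) * x.x₂), -x.x₃⟩ := rfl

theorem mul_def (x y : Bab g hg k a b) : x * y =
    ⟨x.x₁ + gpow g ((a + 1) * x.x₃) * y.x₁, x.x₂ + gpow g ((b + k) * x.x₃) * y.x₂,
      x.x₃ + y.x₃⟩ := rfl

theorem one_def : (1 : Bab g hg k a b) = ⟨0, 0, 0⟩ := rfl

theorem inv_def (x : Bab g hg k a b) : x⁻¹ =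
    ⟨-(gpow g ((a + 1) * -x.x₃) * x.x₁), -(gpow g ((b + k) * -x.x₃) * x.x₂), -x.x₃⟩ := rfl

instance : AddGroup (Bab g hg k a b) :=
  AddGroup.ofLeftAxioms
    (fun x y z => by
      ext
      · simp only [add_def, gpow_add g hg, Units.val_mul]; ring
      · simp only [add_def, mul_add, gpow_add g hg, Units.val_mul]; ring
      · simp only [add_def, add_assoc])
    (fun x => by ext <;> simp [add_def, zero_def, gpow_zero])
    (fun x => by ext <;> simp [add_def, neg_def, zero_def])

instance : Group (Bab g hg k a b) :=
  Group.ofLeftAxioms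
    (fun x y z => by
      ext
      · simp only [mul_def, mul_add, gpow_add g hg, Units.val_mul]; ring
      · simp only [mul_def, mul_add, gpow_add g hg, Units.val_mul]; ring
      · simp only [mul_def, add_assoc])
    (fun x => by ext <;> simp [mul_def, one_def, gpow_zero])
    (fun x => by ext <;> simp [mul_def, inv_def, one_def])

/-- The skew brace `B_{a,b}` of `𝒢_k`-type. -/
instance : SkewBrace (Bab g hg k a b) where
  mul_add_skew x y z := by
    have h (m : ZMod q) : gpow g m * gpow g (-m) = 1 := by
      rw [← gpow_add g hg, add_neg_cancel, gpow_zero]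
    have h' (m : ZMod q) : (gpow g m : ZMod p) * (gpow g (-m) : (ZMod p)ˣ) = 1 := by
      rw [← Units.val_mul, h, Units.val_one]
    rw [sub_eq_add_neg]
    ext
    · simp only [add_def, mul_def, neg_def, add_mul, one_mul, gpow_add g hg, Units.val_mul]
      linear_combination (-(gpow g (a * x.x₃) * gpow g x.x₃ * gpow g y.x₃ * z.x₁ : ZMod p)) *
        h' x.x₃
    · simp only [add_def, mul_def, neg_def, add_mul, mul_add, mul_neg, gpow_add g hg,
        Units.val_mul]
      linear_combination
        (-(gpow g (b * x.x₃) * gpow g (k * x.x₃) * gpow g (k * y.x₃) * z.x₂ : ZMod p)) *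
          h' (k * x.x₃)
    · simp only [add_def, mul_def, neg_def]; ring

end Bab

end Groups

/-- A skew brace on a type. -/
structure Bundled where
  carrier : Type
  [str : SkewBrace carrier]

attribute [instance] Bundled.str

/-- The skew braces of `G`-type with `|ker λ| = n`. -/
def OfTypeKer (G : Type) [Group G] (n : ℕ) : Type 1 :=
  {B : Bundled // IsOfType B.carrier G ∧ Nat.card (lam B.carrier).ker = n}

/-- Isomorphism of skew braces: a bijection preserving both operations. -/
def isoSetoid (G : Type) [Group G] (n : ℕ) : Setoid (OfTypeKer G n) where
  r B C := Nonempty (B.1.carrier ≃+* C.1.carrier)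
  iseqv :=
    ⟨fun _ => ⟨RingEquiv.refl _⟩, fun ⟨e⟩ => ⟨e.symm⟩, fun ⟨e⟩ ⟨f⟩ => ⟨e.trans f⟩⟩

/-- The number of isomorphism classes of skew braces of `G`-type with `|ker λ| = n`. -/
noncomputable def numIsoClasses (G : Type) [Group G] (n : ℕ) : ℕ :=
  Nat.card (Quotient (isoSetoid G n))

end SkewBrace

/-!
Write `A` for the additive group of `B_{a,b}`, that is `𝒢_k` in coordinates, and `P = (ℤ/p)²` for
its normal Sylow subgroup.

The condition `k ≠ ±1` makes `Aut A` rigid (`Bab.exists_diagonal`): conjugation by an element of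
third coordinate `1` has the distinct eigenvalues `g`, `g ^ k` on `P`, and `k² ≠ 1` prevents an
automorphism from exchanging the two eigenlines. So every automorphism is diagonal on `P` and
trivial on `A / P`. An isomorphism `B_{a,b} → B_{c,d}` is in particular one of additive groups, so
it respects the eigenlines and the generator of `A / P`; comparing the eigenvalues of this generator
under `∘`-conjugation on `P` gives `(a, b) = (c, d)` (`Bab.eq_of_ringEquiv`).

Now let `B` be a skew brace of `𝒢_k`-type with `|ker λ| = p²`. On `ker λ` the two operations
agree, so `ker λ` is an additive subgroup of order `p²`, hence is `P` (`mem_ker_lam_iff_x₃`).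
Since every `λ_x` is trivial on `A / P`, the third coordinate is a homomorphism for `∘` too, and
`λ_x` is the `x₃`-th power of `σ = λ_s`, where `s` has third coordinate `1` and `σ ^ q = 1`.
As `q` is prime to `p`, the affine map induced by `σ` on the coset of elements with third
coordinate `1` has a fixed point, which is conjugate under `P` to `(0, 0, 1)`. After this
conjugation `σ = diag(g ^ a, g ^ b, 1)` (`Bab.exists_conj_diagonal`), and `B` becomes `B_{a,b}`
(`exists_ringEquiv_Bab`).
-/

namespace SkewBrace

/-! ### Powers of `g` -/

section Powers

variable {p q : ℕ} [Fact p.Prime] [Fact q.Prime] {g : (ZMod p)ˣ}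

theorem gpow_one : gpow g (1 : ZMod q) = g := by
  have : Fact (1 < q) := ⟨(Fact.out : q.Prime).one_lt⟩
  simp [gpow, ZMod.val_one]

theorem gpow_injective (hg : orderOf g = q) : Function.Injective (gpow g : ZMod q → (ZMod p)ˣ) := by
  intro m n h
  subst hg
  exact ZMod.val_injective _ ((IsPrimitiveRoot.orderOf g).pow_inj m.val_lt n.val_lt h)

theorem coe_gpow_injective (hg : orderOf g = q) :
    Function.Injective (fun m : ZMod q => (gpow g m : ZMod p)) :=
  Units.val_injective.comp (gpow_injective hg)

theorem coe_gpow_eq_one_iff (hg : orderOf g = q) {m : ZMod q} :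
    (gpow g m : ZMod p) = 1 ↔ m = 0 := by
  rw [← (coe_gpow_injective hg).eq_iff, gpow_zero, Units.val_one]

theorem gpow_mul (hg : orderOf g = q) (m n : ZMod q) : gpow g (m * n) = gpow g m ^ n.val := by
  have h := pow_mod_orderOf g (m.val * n.val)
  rw [gpow, gpow, ZMod.val_mul, ← pow_mul, ← h]
  simp only [hg]

theorem exists_gpow_eq (hg : orderOf g = q) {α : ZMod p} (hα : α ^ q = 1) :
    ∃ a : ZMod q, (gpow g a : ZMod p) = α := by
  have hprim : IsPrimitiveRoot (g : ZMod p) q :=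
    IsPrimitiveRoot.coe_units_iff.2 (hg ▸ IsPrimitiveRoot.orderOf g)
  obtain ⟨i, hi, rfl⟩ := hprim.eq_pow_of_pow_eq_one hα
  exact ⟨i, by rw [gpow, ZMod.val_natCast_of_lt hi, Units.val_pow_eq_pow_val]⟩

theorem natCast_ne_zero_of_modEq_one (hpq : p ≡ 1 [MOD q]) : (q : ZMod p) ≠ 0 := by
  intro h
  have hp := (Fact.out : p.Prime)
  have hq := (Fact.out : q.Prime)
  have hd : p = q := (Nat.prime_dvd_prime_iff_eq hp hq).1 ((ZMod.natCast_eq_zero_iff _ _).1 h)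
  subst hd
  have h1 : (p : ZMod p) = (1 : ℕ) := (ZMod.natCast_eq_natCast_iff _ _ _).2 hpq
  simp at h1

end Powers

namespace Bab

/-! ### Isomorphisms of the additive groups -/

section Rigidity

variable {p q : ℕ} [Fact p.Prime] [Fact q.Prime] {g : (ZMod p)ˣ} {hg : orderOf g = q}
  {k a b c d : ZMod q}

/-- The third coordinate, as a homomorphism of additive groups. -/
def proj₃ : Bab g hg k a b →+ ZMod q where
  toFun := x₃
  map_zero' := rfl
  map_add' _ _ := rfl

/-- The inclusion of the normal subgroup `(ℤ/p)²`. -/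
def plane : ZMod p × ZMod p →+ Bab g hg k a b where
  toFun v := ⟨v.1, v.2, 0⟩
  map_zero' := rfl
  map_add' v w := by ext <;> simp [add_def, gpow_zero]

/-- The generator `(0, 0, 1)` of the complement `ℤ/q`. -/
def gen : Bab g hg k a b := ⟨0, 0, 1⟩

theorem nsmul_gen (n : ℕ) : n • (gen : Bab g hg k a b) = ⟨0, 0, n⟩ := by
  induction n with
  | zero => simp [zero_def]
  | succ n ih => rw [succ_nsmul, ih]; ext <;> simp [add_def, gen]

theorem eq_plane_add_nsmul_gen (x : Bab g hg k a b) :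
    x = plane (x.x₁, x.x₂) + x.x₃.val • gen := by
  rw [nsmul_gen]
  ext <;> simp [plane, add_def]

theorem gen_add_plane (v : ZMod p × ZMod p) :
    (gen + plane v : Bab g hg k a b) =
      plane ((g : ZMod p) * v.1, (gpow g k : ZMod p) * v.2) + gen := by
  ext <;> simp [plane, gen, add_def, gpow_zero, gpow_one]

/-- `(ℤ/p)²` is killed by `p`, which is `1` in `ℤ/q`. -/
theorem x₃_apply_plane (hpq : p ≡ 1 [MOD q]) (τ : Bab g hg k a b →+ Bab g hg k c d)
    (v : ZMod p × ZMod p) : (τ (plane v)).x₃ = 0 := by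
  have h : proj₃ (τ (plane (p • v))) = p • (τ (plane v)).x₃ := by
    rw [map_nsmul, map_nsmul, map_nsmul]; rfl
  have hv : p • v = 0 := by ext <;> simp
  have h1 : (p : ZMod q) = (1 : ℕ) := (ZMod.natCast_eq_natCast_iff _ _ _).2 hpq
  rw [hv, map_zero, map_zero, map_zero, nsmul_eq_mul, h1] at h
  simpa using h.symm

/-- An isomorphism of the additive groups acts diagonally on `(ℤ/p)²` and trivially on the quotient
`ℤ/q`: conjugation by the image of `gen` has on `(ℤ/p)²` the eigenvalues `g`, `g ^ k`, and an
exchange of the two eigenlines would force `k² = 1`. -/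
theorem exists_diagonal (hpq : p ≡ 1 [MOD q]) (hk : k ≠ 1) (hk' : k ≠ -1)
    (τ : Bab g hg k a b ≃+ Bab g hg k c d) :
    ∃ α β : ZMod p, α ≠ 0 ∧ β ≠ 0 ∧ (∀ v, τ (plane v) = plane (α * v.1, β * v.2)) ∧
      ∀ x, (τ x).x₃ = x.x₃ := by
  have h3 := x₃_apply_plane hpq (τ : Bab g hg k a b →+ Bab g hg k c d)
  replace h3 : ∀ v, (τ (plane v)).x₃ = 0 := h3
  let F₁ : ZMod p × ZMod p →+ ZMod p :=
    { toFun := fun v => (τ (plane v)).x₁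
      map_zero' := by rw [map_zero, map_zero, zero_def]
      map_add' := fun v w => by simp [map_add, add_def (τ _), h3, gpow_zero] }
  let F₂ : ZMod p × ZMod p →+ ZMod p :=
    { toFun := fun v => (τ (plane v)).x₂
      map_zero' := by rw [map_zero, map_zero, zero_def]
      map_add' := fun v w => by simp [map_add, add_def (τ _), h3, gpow_zero] }
  have lin (F : ZMod p × ZMod p →+ ZMod p) (v : ZMod p × ZMod p) :
      F v = F (1, 0) * v.1 + F (0, 1) * v.2 := by
    conv_lhs => rw [show v = v.1 • ((1, 0) : ZMod p × ZMod p) + v.2 • ((0, 1) : ZMod p × ZMod p) by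
      ext <;> simp]
    rw [map_add, ZMod.map_smul, ZMod.map_smul, smul_eq_mul, smul_eq_mul, mul_comm, mul_comm v.2]
  have hτ (v) : τ (plane v) = plane (F₁ v, F₂ v) := by
    ext
    · rfl
    · rfl
    · exact h3 v
  have hrel (v : ZMod p × ZMod p) := congrArg τ (gen_add_plane (hg := hg) (a := a) (b := b) v)
  simp only [map_add, hτ] at hrel
  have r₁ (v : ZMod p × ZMod p) := congrArg x₁ (hrel v)
  have r₂ (v : ZMod p × ZMod p) := congrArg x₂ (hrel v)
  simp only [add_def, plane, AddMonoidHom.coe_mk, ZeroHom.coe_mk, mul_zero, gpow_zero,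
    Units.val_one, one_mul] at r₁ r₂
  set m := (τ gen).x₃ with hm
  replace r₁ (v : ZMod p × ZMod p) :
      (gpow g m : ZMod p) * F₁ v =
        F₁ (1, 0) * (g * v.1) + F₁ (0, 1) * (gpow g k * v.2) := by
    have h := lin F₁ ((g : ZMod p) * v.1, (gpow g k : ZMod p) * v.2)
    dsimp only at h
    linear_combination r₁ v + h
  replace r₂ (v : ZMod p × ZMod p) :
      (gpow g (k * m) : ZMod p) * F₂ v =
        F₂ (1, 0) * (g * v.1) + F₂ (0, 1) * (gpow g k * v.2) := by
    have h := lin F₂ ((g : ZMod p) * v.1, (gpow g k : ZMod p) * v.2)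
    dsimp only at h
    linear_combination r₂ v + h
  -- each nonzero matrix entry forces an equality of two eigenvalues, hence of exponents
  have ex {i j : ZMod q} {x : ZMod p} (hx : x ≠ 0)
      (h : (gpow g i : ZMod p) * x = (gpow g j : ZMod p) * x) : i = j :=
    coe_gpow_injective hg (mul_right_cancel₀ hx h)
  have e₁ : F₁ (1, 0) ≠ 0 → m = 1 := fun h => ex h (by
    have := r₁ (1, 0)
    simp only [mul_one, mul_zero, add_zero] at this
    rw [this, gpow_one, mul_comm])
  have e₂ : F₁ (0, 1) ≠ 0 → m = k := fun h => ex h (by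
    have := r₁ (0, 1)
    simp only [mul_one, mul_zero, zero_add] at this
    rw [this, mul_comm])
  have e₃ : F₂ (1, 0) ≠ 0 → k * m = 1 := fun h => ex h (by
    have := r₂ (1, 0)
    simp only [mul_one, mul_zero, add_zero] at this
    rw [this, gpow_one, mul_comm])
  have e₄ : F₂ (0, 1) ≠ 0 → k * m = k := fun h => ex h (by
    have := r₂ (0, 1)
    simp only [mul_one, mul_zero, zero_add] at this
    rw [this, mul_comm])
  have inj (v : ZMod p × ZMod p) (h₁ : F₁ v = 0) (h₂ : F₂ v = 0) : v = 0 := by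
    have h : τ (plane v) = τ 0 := by rw [hτ, h₁, h₂, map_zero]; rfl
    have h := τ.injective h
    exact Prod.ext (congrArg x₁ h) (congrArg x₂ h)
  have hsq : k * k ≠ 1 := fun h => by
    rcases mul_self_eq_one_iff.1 h with h | h
    exacts [hk h, hk' h]
  -- otherwise the two eigenlines are exchanged, so that `m = k` and `k * m = 1`
  have hα : F₁ (1, 0) ≠ 0 := by
    intro h₁
    have h₃ : F₂ (1, 0) ≠ 0 := fun h₃ => by simpa using inj (1, 0) h₁ h₃
    have h₂ : F₁ (0, 1) ≠ 0 := by
      intro h₂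
      have := inj (F₂ (0, 1), -F₂ (1, 0)) (by rw [lin F₁, h₁, h₂]; simp)
        (by rw [lin F₂]; ring)
      exact h₃ (by simpa using congrArg Prod.snd this)
    exact hsq (by rw [← e₃ h₃, e₂ h₂])
  have hm1 := e₁ hα
  have h₂ : F₁ (0, 1) = 0 := by
    by_contra h; exact hk ((e₂ h).symm.trans hm1)
  have h₃ : F₂ (1, 0) = 0 := by
    by_contra h; exact hk (by have := e₃ h; rwa [hm1, mul_one] at this)
  refine ⟨F₁ (1, 0), F₂ (0, 1), hα, fun h => ?_, fun v => ?_, fun x => ?_⟩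
  · simpa using inj (0, 1) h₂ h
  · rw [hτ, lin F₁ v, lin F₂ v, h₂, h₃, zero_mul, zero_mul, add_zero, zero_add]
  · conv_lhs => rw [eq_plane_add_nsmul_gen x]
    rw [map_add, map_nsmul]
    change (τ _).x₃ + proj₃ (x.x₃.val • τ gen) = _
    rw [h3, map_nsmul, zero_add]
    change x.x₃.val • m = _
    rw [hm1, nsmul_eq_mul, mul_one, ZMod.natCast_zmod_val]

/-! ### Diagonalisation of automorphisms of order `q` -/

theorem plane_add_gen (v : ZMod p × ZMod p) :
    (plane v + gen : Bab g hg k a b) = ⟨v.1, v.2, 1⟩ := by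
  ext <;> simp [plane, gen, add_def, gpow_zero]

/-- An affine map of finite order prime to the characteristic has a fixed point. The fixed point
can be taken to be `0` when the map is linear. -/
theorem exists_fixed_of_iterate_affine {K : Type*} [Field K] {n : ℕ} (hn : (n : K) ≠ 0) (α c : K)
    (h : (fun x => α * x + c)^[n] 0 = 0) : ∃ x, α * x + c = x ∧ (c = 0 → x = 0) := by
  by_cases hα : α = 1
  · subst hα
    have hi (m : ℕ) : (fun x => 1 * x + c)^[m] 0 = m * c := by
      induction m with
      | zero => simp
      | succ m ih => rw [Function.iterate_succ_apply', ih]; push_cast; ring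
    rw [hi] at h
    have hc : c = 0 := (mul_eq_zero.1 h).resolve_left hn
    exact ⟨0, by simp [hc], fun _ => rfl⟩
  · have h1 : 1 - α ≠ 0 := sub_ne_zero.2 (Ne.symm hα)
    refine ⟨c / (1 - α), by field_simp; ring, fun hc => by simp [hc]⟩

/-- When `k = 0` the second coordinate is a homomorphism to `ℤ/p`, so it vanishes on the image of
`gen`, an element of order dividing `q`. -/
theorem x₂_apply_gen_eq_zero (hqp : (q : ZMod p) ≠ 0) (τ : Bab g hg k a b →+ Bab g hg k c d)
    (hk : k = 0) : (τ gen).x₂ = 0 := by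
  subst hk
  have hi (n : ℕ) (x : Bab g hg 0 c d) : (n • x).x₂ = n * x.x₂ := by
    induction n with
    | zero => simp [zero_def]
    | succ n ih => rw [succ_nsmul, add_def]; simp [ih, gpow_zero]; ring
  have h : τ (q • gen) = 0 := by
    rw [nsmul_gen, ← map_zero τ]; congr 1; simp [zero_def]
  rw [map_nsmul] at h
  have h := congrArg x₂ h
  rw [hi] at h
  exact (mul_eq_zero.1 h).resolve_left hqp

/-- An automorphism of the additive group whose `q`-th power fixes `gen` is diagonal after
conjugation: it fixes a point of the coset of `gen` (with second coordinate `0` when `k = 0`), and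
this point is conjugate to `gen` under `(ℤ/p)²`. -/
theorem exists_conj_diagonal (hpq : p ≡ 1 [MOD q]) (hk : k ≠ 1) (hk' : k ≠ -1)
    (τ : Bab g hg k a b ≃+ Bab g hg k a b) (hτ : τ^[q] gen = gen) :
    ∃ (ρ : Bab g hg k a b ≃+ Bab g hg k a b) (α β : ZMod p),
      ∀ x, ρ (τ (ρ.symm x)) = ⟨α * x.x₁, β * x.x₂, x.x₃⟩ := by
  have hqp : (q : ZMod p) ≠ 0 := natCast_ne_zero_of_modEq_one hpq
  obtain ⟨α, β, -, -, hpl, h3⟩ := exists_diagonal hpq hk hk' τ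
  obtain ⟨c₁, c₂, hgen⟩ : ∃ c₁ c₂, τ gen = ⟨c₁, c₂, 1⟩ :=
    ⟨(τ gen).x₁, (τ gen).x₂, by ext <;> [rfl; rfl; exact h3 gen]⟩
  have hc₂ (h : k = 0) : c₂ = 0 := by
    have : (τ gen).x₂ = 0 := x₂_apply_gen_eq_zero hqp (τ : Bab g hg k a b →+ Bab g hg k a b) h
    rwa [hgen] at this
  have haff (u v : ZMod p) : τ ⟨u, v, 1⟩ = ⟨α * u + c₁, β * v + c₂, 1⟩ := by
    rw [← plane_add_gen (u, v), map_add, hpl, hgen]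
    ext <;> simp [plane, add_def, gpow_zero]
  have hit (n : ℕ) : τ^[n] gen =
      ⟨(fun x => α * x + c₁)^[n] 0, (fun x => β * x + c₂)^[n] 0, 1⟩ := by
    induction n with
    | zero => rfl
    | succ n ih => simp only [Function.iterate_succ_apply', ih, haff]
  rw [hit] at hτ
  obtain ⟨u, hu, -⟩ := exists_fixed_of_iterate_affine hqp α c₁ (congrArg x₁ hτ)
  obtain ⟨v, hv, hv0⟩ := exists_fixed_of_iterate_affine hqp β c₂ (congrArg x₂ hτ)
  have hfix : τ ⟨u, v, 1⟩ = ⟨u, v, 1⟩ := by rw [haff, hu, hv]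
  -- for `k = 0` the second entry is `0 / 0 = 0`, as it has to be
  let w : ZMod p × ZMod p := (u / (1 - g), v / (1 - gpow g k))
  have hw : plane w + gen = (⟨u, v, 1⟩ : Bab g hg k a b) + plane w := by
    have hg1 : 1 - (g : ZMod p) ≠ 0 := by
      intro h
      have := (coe_gpow_eq_one_iff (g := g) hg (m := 1)).1 (by
        rw [gpow_one]; linear_combination -h)
      exact one_ne_zero this
    have hv' : v / (1 - (gpow g k : ZMod p)) =
        v + (gpow g k : ZMod p) * (v / (1 - (gpow g k : ZMod p))) := by
      by_cases h0 : k = 0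
      · simp [hv0 (hc₂ h0)]
      · have : 1 - (gpow g k : ZMod p) ≠ 0 := fun h =>
          h0 ((coe_gpow_eq_one_iff hg).1 (by linear_combination -h))
        field_simp
        ring
    rw [plane_add_gen]
    ext
    · simp only [w, add_def, plane, AddMonoidHom.coe_mk, ZeroHom.coe_mk, gpow_one]
      field_simp
      ring
    · simpa [w, add_def, plane] using hv'
    · simp [add_def, plane]
  let ρ := AddAut.addConj (plane w : Bab g hg k a b)
  have hρgen : ρ gen = ⟨u, v, 1⟩ := by
    rw [AddAut.addConj_apply, hw, add_neg_cancel_right]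
  have hρpl (x : ZMod p × ZMod p) : ρ (plane x) = plane x := by
    rw [AddAut.addConj_apply, ← map_add, add_comm w x, map_add, add_neg_cancel_right]
  refine ⟨AddEquiv.symm ρ, α, β, fun x => ?_⟩
  rw [AddEquiv.symm_symm, AddEquiv.symm_apply_eq]
  have e : (⟨α * x.x₁, β * x.x₂, x.x₃⟩ : Bab g hg k a b) =
      plane (α * x.x₁, β * x.x₂) + x.x₃.val • gen := eq_plane_add_nsmul_gen _
  rw [e]
  conv_lhs => rw [eq_plane_add_nsmul_gen x]
  simp only [map_add, map_nsmul, hρpl, hρgen, hpl, hfix]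

/-! ### The skew braces `B_{a,b}` are pairwise non-isomorphic -/

theorem gen_mul_plane (v : ZMod p × ZMod p) :
    (gen * plane v : Bab g hg k a b) =
      plane ((gpow g (a + 1) : ZMod p) * v.1, (gpow g (b + k) : ZMod p) * v.2) * gen := by
  ext <;> simp [plane, gen, mul_def, gpow_zero]

/-- The eigenvalues of `gen` acting by `∘`-conjugation on `(ℤ/p)²` are invariants. -/
theorem eq_of_ringEquiv (hpq : p ≡ 1 [MOD q]) (hk : k ≠ 1) (hk' : k ≠ -1)
    (φ : Bab g hg k a b ≃+* Bab g hg k c d) : a = c ∧ b = d := by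
  obtain ⟨α, β, hα, hβ, hpl, h3⟩ := exists_diagonal hpq hk hk' (φ : Bab g hg k a b ≃+ Bab g hg k c d)
  replace hpl : ∀ v, φ (plane v) = plane (α * v.1, β * v.2) := hpl
  have h3 : (φ gen).x₃ = 1 := h3 gen
  have h := congrArg φ (gen_mul_plane (hg := hg) (k := k) (a := a) (b := b) (1, 1))
  simp only [map_mul, hpl] at h
  have h₁ := congrArg x₁ h
  have h₂ := congrArg x₂ h
  simp only [mul_def, h3, plane, AddMonoidHom.coe_mk, ZeroHom.coe_mk, mul_zero, mul_one, gpow_zero,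
    Units.val_one, one_mul] at h₁ h₂
  constructor
  · exact (add_right_cancel (coe_gpow_injective hg (mul_right_cancel₀ hα
      (show _ * α = _ * α by linear_combination h₁)))).symm
  · exact (add_right_cancel (coe_gpow_injective hg (mul_right_cancel₀ hβ
      (show _ * β = _ * β by linear_combination h₂)))).symm

end Rigidity

/-! ### The groups of `B_{a,b}` -/

section Structure

variable {p q : ℕ} [Fact p.Prime] [Fact q.Prime] {g : (ZMod p)ˣ} {hg : orderOf g = q}
  {k a b : ZMod q}

theorem diagAction_left (v : Multiplicative (ZMod p × ZMod p)) (a b : ZMod q)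
    (n : Multiplicative (ZMod q)) : diagAction g hg a b n v =
      .ofAdd ((gpow g (a * n.toAdd) : ZMod p) * v.toAdd.1,
        (gpow g (b * n.toAdd) : ZMod p) * v.toAdd.2) := rfl

variable (g hg k a b)

/-- The coordinates identify `(B_{a,b}, +)` with `𝒢_k`. -/
def addEquivGK : Multiplicative (Bab g hg k a b) ≃* GK g hg k where
  toFun x := ⟨.ofAdd (x.toAdd.x₁, x.toAdd.x₂), .ofAdd x.toAdd.x₃⟩
  invFun y := .ofAdd ⟨y.left.toAdd.1, y.left.toAdd.2, y.right.toAdd⟩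
  left_inv _ := rfl
  right_inv _ := rfl
  map_mul' x y := by
    ext <;> simp [diagAction_left, add_def]

/-- Rescaling the generator of the complement `ℤ/q` by a unit `m` identifies `(B_{a,b}, ∘)` with
the semidirect product of any `D_{c,d}` with `(a + 1, b + k) = m (c, d)`. -/
def mulEquivDiagProd (c d m : ZMod q) (hm : m ≠ 0) (hc : a + 1 = c * m) (hd : b + k = d * m) :
    Bab g hg k a b ≃* DiagProd g hg c d where
  toFun x := ⟨.ofAdd (x.x₁, x.x₂), .ofAdd (m * x.x₃)⟩
  invFun y := ⟨y.left.toAdd.1, y.left.toAdd.2, m⁻¹ * y.right.toAdd⟩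
  left_inv x := by ext <;> simp [hm]
  right_inv y := by ext <;> simp [hm]
  map_mul' x y := by
    ext <;> simp [diagAction_left, mul_def, hc, hd, mul_assoc, mul_add]

/-- For `a = -1` the roles of the two coordinates of `(ℤ/p)²` are exchanged. -/
def mulEquivGKZero (ha : a = -1) (hb : b ≠ -k) : Bab g hg k a b ≃* GK g hg 0 where
  toFun x := ⟨.ofAdd (x.x₂, x.x₁), .ofAdd ((b + k) * x.x₃)⟩
  invFun y := ⟨y.left.toAdd.2, y.left.toAdd.1, (b + k)⁻¹ * y.right.toAdd⟩
  left_inv x := by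
    have h : b + k ≠ 0 := fun h => hb (eq_neg_of_add_eq_zero_left h)
    ext <;> simp [h]
  right_inv y := by
    have h : b + k ≠ 0 := fun h => hb (eq_neg_of_add_eq_zero_left h)
    ext <;> simp [h]
  map_mul' x y := by
    ext <;> simp [diagAction_left, mul_def, ha, mul_add]

/-- For `(a, b) = (-1, -k)` the group `(B_{a,b}, ∘)` is the direct product. -/
def mulEquivProd (ha : a = -1) (hb : b = -k) :
    Bab g hg k a b ≃* Multiplicative ((ZMod p × ZMod p) × ZMod q) where
  toFun x := .ofAdd ((x.x₁, x.x₂), x.x₃)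
  invFun y := ⟨y.toAdd.1.1, y.toAdd.1.2, y.toAdd.2⟩
  left_inv _ := rfl
  right_inv _ := rfl
  map_mul' x y := by
    simp [mul_def, ha, hb, gpow_zero, ← ofAdd_add]

/-- The additive group of `B_{a,b}` does not depend on `a` and `b`. -/
def addEquivOfParams (c d : ZMod q) : Bab g hg k a b ≃+ Bab g hg k c d where
  toFun x := ⟨x.x₁, x.x₂, x.x₃⟩
  invFun x := ⟨x.x₁, x.x₂, x.x₃⟩
  left_inv _ := rfl
  right_inv _ := rfl
  map_add' _ _ := rfl

variable {g hg k a b}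

theorem isOfType : IsOfType (Bab g hg k a b) (GK g hg k) := ⟨addEquivGK g hg k a b⟩

theorem isBiSkew : IsBiSkew (Bab g hg k a b) := by
  intro x y z
  have h' (m : ZMod q) : (gpow g m : ZMod p) * (gpow g (-m) : (ZMod p)ˣ) = 1 := by
    rw [← Units.val_mul, ← gpow_add g hg, add_neg_cancel, gpow_zero, Units.val_one]
  ext
  · simp only [add_def, mul_def, inv_def, mul_add, mul_neg, gpow_add g hg, Units.val_mul]
    linear_combination (-gpow g ((a + 1) * y.x₃) * (gpow g x.x₃ * z.x₁)) *
      h' ((a + 1) * x.x₃)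
  · simp only [add_def, mul_def, inv_def, mul_add, mul_neg, gpow_add g hg, Units.val_mul]
    linear_combination (-gpow g ((b + k) * y.x₃) * (gpow g (k * x.x₃) * z.x₂)) *
      h' ((b + k) * x.x₃)
  · simp only [add_def, mul_def, inv_def]; ring

end Structure

end Bab

/-! ### The automorphisms `λ_x` -/

section Lambda

variable {B : Type u} [SkewBrace B]

theorem mul_eq_add_lamAut (x y : B) : x * y = x + lamAut B x y :=
  (add_neg_cancel_left x (x * y)).symm

theorem lamAut_mul_apply (x y z : B) : lamAut B (x * y) z = lamAut B x (lamAut B y z) :=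
  DFunLike.congr_fun (congrArg Multiplicative.toAdd (map_mul (lam B) x y)) z

theorem lamAut_one_apply (z : B) : lamAut B 1 z = z :=
  DFunLike.congr_fun (congrArg Multiplicative.toAdd (map_one (lam B))) z

theorem lamAut_pow_apply (x : B) (n : ℕ) (z : B) : lamAut B (x ^ n) z = (lamAut B x)^[n] z := by
  induction n with
  | zero => rw [pow_zero, lamAut_one_apply, Function.iterate_zero, id]
  | succ n ih => rw [pow_succ', lamAut_mul_apply, ih, Function.iterate_succ_apply']

theorem mem_ker_lam {x : B} : x ∈ (lam B).ker ↔ ∀ y, lamAut B x y = y := by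
  rw [MonoidHom.mem_ker]
  constructor
  · intro h y
    exact DFunLike.congr_fun (congrArg Multiplicative.toAdd h) y
  · intro h
    exact congrArg Multiplicative.ofAdd (DFunLike.ext (lamAut B x) 0 h)

theorem one_eq_zero : (1 : B) = 0 := by
  rw [← mul_zero_skew B 1, one_mul]

/-- The two operations agree on `ker λ`. -/
theorem pow_eq_nsmul_of_mem_ker {x : B} (hx : x ∈ (lam B).ker) (n : ℕ) : x ^ n = n • x := by
  induction n with
  | zero => rw [pow_zero, zero_nsmul, one_eq_zero]
  | succ n ih => rw [pow_succ', ih, mul_eq_add_lamAut, mem_ker_lam.1 hx, succ_nsmul']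

theorem IsBiSkew.of_ringEquiv {C : Type*} [SkewBrace C] (e : B ≃+* C) (hC : IsBiSkew C) :
    IsBiSkew B := by
  intro x y z
  apply e.injective
  have hinv : e x⁻¹ = (e x)⁻¹ := map_inv (e : B ≃* C) x
  simp only [map_add, map_mul, hinv, hC (e x) (e y) (e z)]

end Lambda

open Bab

variable {p q : ℕ} [Fact p.Prime] [Fact q.Prime] {g : (ZMod p)ˣ} {hg : orderOf g = q}
  {k a b : ZMod q}

/-! ### The kernel of `λ` -/

theorem Bab.natCard_plane : Nat.card {x : Bab g hg k a b // x.x₃ = 0} = p ^ 2 := by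
  let e : {x : Bab g hg k a b // x.x₃ = 0} ≃ ZMod p × ZMod p :=
    { toFun := fun x => (x.1.x₁, x.1.x₂)
      invFun := fun v => ⟨plane v, rfl⟩
      left_inv := fun ⟨x, hx⟩ => by
        apply Subtype.ext
        ext
        exacts [rfl, rfl, hx.symm]
      right_inv := fun _ => rfl }
  rw [Nat.card_congr e, Nat.card_prod, Nat.card_zmod, sq]

theorem Bab.mem_ker_lam_iff (h : (a, b) ≠ (0, 0)) {x : Bab g hg k a b} :
    x ∈ (lam (Bab g hg k a b)).ker ↔ x.x₃ = 0 := by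
  have hmul : x ∈ (lam (Bab g hg k a b)).ker ↔ ∀ y, x * y = x + y := by
    simp only [mem_ker_lam, mul_eq_add_lamAut, add_right_inj]
  rw [hmul]
  constructor
  · intro hx
    have h1 := hx (plane (1, 1))
    have h₁ := congrArg Bab.x₁ h1
    have h₂ := congrArg Bab.x₂ h1
    simp only [mul_def, add_def, plane, AddMonoidHom.coe_mk, ZeroHom.coe_mk, mul_one,
      add_right_inj] at h₁ h₂
    have e₁ := coe_gpow_injective hg h₁
    have e₂ := coe_gpow_injective hg h₂
    by_contra h3
    apply h
    ext
    · exact (mul_eq_zero.1 (by linear_combination e₁ : a * x.x₃ = 0)).resolve_right h3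
    · exact (mul_eq_zero.1 (by linear_combination e₂ : b * x.x₃ = 0)).resolve_right h3
  · intro hx y
    ext <;> simp [mul_def, add_def, hx]

theorem Bab.natCard_ker_lam (h : (a, b) ≠ (0, 0)) :
    Nat.card (lam (Bab g hg k a b)).ker = p ^ 2 := by
  rw [← Bab.natCard_plane (hg := hg) (k := k) (a := a) (b := b)]
  exact Nat.card_congr (Equiv.subtypeEquivRight fun x => Bab.mem_ker_lam_iff h)

/-! ### Classification -/

section Classification

variable {B : Type u} [SkewBrace B]

/-- For an additive isomorphism `f` with `𝒢_k`, the kernel of `λ` corresponds to `(ℤ/p)²`: it is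
contained in it, being a `p`-group for `+`, and has the same order. -/
theorem mem_ker_lam_iff_x₃ (hpq : p ≡ 1 [MOD q]) (hker : Nat.card (lam B).ker = p ^ 2)
    (f : B ≃+ Bab g hg k a b) (x : B) : x ∈ (lam B).ker ↔ (f x).x₃ = 0 := by
  have hp1 : (p : ZMod q) = 1 := by
    simpa using (ZMod.natCast_eq_natCast_iff p 1 q).2 hpq
  have hsub (x : B) (hx : x ∈ (lam B).ker) : (f x).x₃ = 0 := by
    have h1 : (⟨x, hx⟩ : (lam B).ker) ^ p ^ 2 = 1 := by rw [← hker, pow_card_eq_one']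
    have h2 : p ^ 2 • x = 0 := by
      rw [← pow_eq_nsmul_of_mem_ker hx, ← one_eq_zero]
      exact congrArg Subtype.val h1
    have h3 : proj₃ (f (p ^ 2 • x)) = 0 := by rw [h2, map_zero, map_zero]
    rw [map_nsmul, map_nsmul, nsmul_eq_mul, Nat.cast_pow, hp1, one_pow, one_mul] at h3
    exact h3
  refine ⟨hsub x, fun hx => ?_⟩
  have hp : p ^ 2 ≠ 0 := pow_ne_zero _ (Fact.out : p.Prime).ne_zero
  have : Finite {x : Bab g hg k a b // x.x₃ = 0} :=
    Nat.finite_of_card_ne_zero (by rw [Bab.natCard_plane]; exact hp)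
  let i : (lam B).ker → {x : Bab g hg k a b // x.x₃ = 0} := fun y => ⟨f y.1, hsub y.1 y.2⟩
  have hi : Function.Injective i := fun y z h =>
    Subtype.ext (f.injective (congrArg Subtype.val h))
  have hbij := (Nat.bijective_iff_injective_and_card i).2 ⟨hi, by rw [hker, Bab.natCard_plane]⟩
  obtain ⟨y, hy⟩ := hbij.2 ⟨f x, hx⟩
  have : y.1 = x := f.injective (congrArg Subtype.val hy)
  exact this ▸ y.2

/-- The maps `λ_x` are the powers of `λ_s` for one `s` of third coordinate `1`; after a conjugation of
the additive group `λ_s` is diagonal, and its eigenvalues `g ^ a`, `g ^ b` give the parameters. -/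
theorem exists_ringEquiv_Bab (hpq : p ≡ 1 [MOD q]) (hk : k ≠ 1) (hk' : k ≠ -1)
    (hB : IsOfType B (GK g hg k)) (hker : Nat.card (lam B).ker = p ^ 2) :
    ∃ a b : ZMod q, (a, b) ≠ (0, 0) ∧ Nonempty (B ≃+* Bab g hg k a b) := by
  obtain ⟨e⟩ := hB
  let f : B ≃+ Bab g hg k 0 0 :=
    AddEquiv.toMultiplicative.symm (e.trans (addEquivGK g hg k 0 0).symm)
  have hmem := mem_ker_lam_iff_x₃ hpq hker f
  have x₃_add (x y : B) : (f (x + y)).x₃ = (f x).x₃ + (f y).x₃ := by rw [map_add]; rfl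
  have x₃_lam (x y : B) : (f (lamAut B x y)).x₃ = (f y).x₃ := by
    obtain ⟨-, -, -, -, -, h⟩ := exists_diagonal hpq hk hk' ((f.symm.trans (lamAut B x)).trans f)
    simpa using h (f y)
  have x₃_mul (x y : B) : (f (x * y)).x₃ = (f x).x₃ + (f y).x₃ := by
    rw [mul_eq_add_lamAut, x₃_add, x₃_lam]
  have x₃_pow (x : B) (n : ℕ) : (f (x ^ n)).x₃ = n * (f x).x₃ := by
    induction n with
    | zero => simp [one_eq_zero, zero_def]
    | succ n ih => rw [pow_succ, x₃_mul, ih]; push_cast; ring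
  -- modulo `ker λ` the two group structures coincide, so `λ` factors through the third coordinate
  have lam_congr (x y z : B) (h : (f x).x₃ = (f y).x₃) : lamAut B x z = lamAut B y z := by
    have hxy : x * y⁻¹ ∈ (lam B).ker := by
      rw [hmem]
      have := x₃_mul (x * y⁻¹) y
      rw [inv_mul_cancel_right, h] at this
      exact left_eq_add.1 (this.trans (add_comm _ _))
    conv_lhs => rw [← inv_mul_cancel_right x y, lamAut_mul_apply]
    exact mem_ker_lam.1 hxy _
  let s : B := f.symm gen
  have hfs : f s = gen := f.apply_symm_apply gen
  have lam_eq (x z : B) : lamAut B x z = (lamAut B s)^[(f x).x₃.val] z := by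
    rw [← lamAut_pow_apply]
    apply lam_congr
    rw [x₃_pow, hfs]
    simp [gen]
  have lam_q (z : B) : (lamAut B s)^[q] z = z := by
    rw [← lamAut_pow_apply, ← lamAut_one_apply z, lam_congr (s ^ q) 1, lamAut_one_apply]
    rw [x₃_pow, one_eq_zero, map_zero]
    simp [zero_def]
  let τ : Bab g hg k 0 0 ≃+ Bab g hg k 0 0 := (f.symm.trans (lamAut B s)).trans f
  have hτ (n : ℕ) (z : B) : τ^[n] (f z) = f ((lamAut B s)^[n] z) := by
    induction n with
    | zero => rfl
    | succ n ih =>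
      rw [Function.iterate_succ_apply', Function.iterate_succ_apply', ih]
      exact congrArg (fun y => f (lamAut B s y)) (f.symm_apply_apply _)
  obtain ⟨ρ, α, β, hρ⟩ := exists_conj_diagonal hpq hk hk' τ (by rw [← hfs, hτ, lam_q])
  obtain ⟨-, -, -, -, -, hρ₃⟩ := exists_diagonal hpq hk hk' ρ
  let f' : B ≃+ Bab g hg k 0 0 := f.trans ρ
  have hf'₃ (x : B) : (f' x).x₃ = (f x).x₃ := hρ₃ (f x)
  have hf's (z : B) : f' (lamAut B s z) =
      ⟨α * (f' z).x₁, β * (f' z).x₂, (f' z).x₃⟩ := by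
    rw [← hρ]
    simp [f', τ]
  have hf'n (n : ℕ) (z : B) : f' ((lamAut B s)^[n] z) =
      ⟨α ^ n * (f' z).x₁, β ^ n * (f' z).x₂, (f' z).x₃⟩ := by
    induction n with
    | zero => simp
    | succ n ih => rw [Function.iterate_succ_apply', hf's, ih]; simp [pow_succ', mul_assoc]
  have hq1 := hf'n q (f'.symm (plane (1, 1)))
  rw [lam_q, f'.apply_symm_apply] at hq1
  obtain ⟨a, ha⟩ := exists_gpow_eq hg (α := α) (by
    simpa [plane] using (congrArg Bab.x₁ hq1).symm)
  obtain ⟨b, hb⟩ := exists_gpow_eq hg (α := β) (by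
    simpa [plane] using (congrArg Bab.x₂ hq1).symm)
  refine ⟨a, b, ?_, ⟨{ f'.trans (addEquivOfParams g hg k 0 0 a b) with map_mul' := ?_ }⟩⟩
  · -- otherwise `λ` would be trivial, whereas `s` is not in its kernel
    rintro h
    obtain ⟨rfl, rfl⟩ := Prod.mk.inj h
    have : s ∈ (lam B).ker := mem_ker_lam.2 fun y => f'.injective (by
      rw [hf's, ← ha, ← hb]
      simp [gpow_zero])
    rw [hmem, hfs] at this
    exact one_ne_zero this
  · intro x y
    change addEquivOfParams g hg k 0 0 a b (f' (x * y)) =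
      addEquivOfParams g hg k 0 0 a b (f' x) * addEquivOfParams g hg k 0 0 a b (f' y)
    rw [mul_eq_add_lamAut, lam_eq, map_add, hf'n, ← ha, ← hb, ← hf'₃ x]
    ext
    · simp only [addEquivOfParams, AddEquiv.coe_mk, Equiv.coe_fn_mk, add_def, mul_def, add_mul,
        one_mul, gpow_add g hg, gpow_mul hg a, Units.val_mul, Units.val_pow_eq_pow_val]
      ring
    · simp only [addEquivOfParams, AddEquiv.coe_mk, Equiv.coe_fn_mk, add_def, mul_def, add_mul,
        gpow_add g hg, gpow_mul hg b, Units.val_mul, Units.val_pow_eq_pow_val]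
      ring
    · rfl

end Classification

/-- The isomorphism classes correspond to the pairs `(a, b) ≠ (0, 0)`. -/
theorem numIsoClasses_GK (hpq : p ≡ 1 [MOD q]) (hk : k ≠ 1) (hk' : k ≠ -1) :
    numIsoClasses (GK g hg k) (p ^ 2) = q ^ 2 - 1 := by
  let F : {v : ZMod q × ZMod q // v ≠ 0} → Quotient (isoSetoid (GK g hg k) (p ^ 2)) := fun v =>
    Quotient.mk _ ⟨⟨Bab g hg k v.1.1 v.1.2⟩, isOfType, Bab.natCard_ker_lam v.2⟩
  have hF : Function.Bijective F := by
    constructor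
    · intro v w h
      obtain ⟨φ⟩ := Quotient.exact h
      obtain ⟨h₁, h₂⟩ := eq_of_ringEquiv hpq hk hk' φ
      exact Subtype.ext (Prod.ext h₁ h₂)
    · intro C
      induction C using Quotient.inductionOn with
      | h C =>
        obtain ⟨a, b, hab, ⟨φ⟩⟩ := exists_ringEquiv_Bab hpq hk hk' C.2.1 C.2.2
        exact ⟨⟨(a, b), hab⟩, Quotient.sound ⟨φ.symm⟩⟩
  rw [numIsoClasses, ← Nat.card_congr (Equiv.ofBijective F hF), Nat.card_eq_fintype_card,
    Fintype.card_subtype_compl, Fintype.card_subtype_eq, Fintype.card_prod, ZMod.card, sq]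

end SkewBrace

theorem mainTheorem6 (p q : ℕ) [Fact p.Prime] [Fact q.Prime] (hq : 2 < q)
    (hpq : p ≡ 1 [MOD q]) (g : (ZMod p)ˣ) (hg : orderOf g = q) (k : ZMod q)
    (hk : k ≠ 1) (hk' : k ≠ -1) :
    -- the skew braces `B_{a,b}`: their operations, their groups, their type and `ker λ`
    (∀ a b : ZMod q, (a, b) ≠ (0, 0) →
      (∀ x y : SkewBrace.Bab g hg k a b, x + y =
        ⟨x.x₁ + SkewBrace.gpow g x.x₃ * y.x₁,
          x.x₂ + SkewBrace.gpow g (k * x.x₃) * y.x₂, x.x₃ + y.x₃⟩) ∧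
      (∀ x y : SkewBrace.Bab g hg k a b, x * y =
        ⟨x.x₁ + SkewBrace.gpow g ((a + 1) * x.x₃) * y.x₁,
          x.x₂ + SkewBrace.gpow g ((b + k) * x.x₃) * y.x₂, x.x₃ + y.x₃⟩) ∧
      (∃ e : Multiplicative (SkewBrace.Bab g hg k a b) ≃* SkewBrace.GK g hg k,
        ∀ x, e (.ofAdd x) = ⟨.ofAdd (x.x₁, x.x₂), .ofAdd x.x₃⟩) ∧
      (∃ e : SkewBrace.Bab g hg k a b ≃* SkewBrace.DiagProd g hg (a + 1) (b + k),
        ∀ x, e x = ⟨.ofAdd (x.x₁, x.x₂), .ofAdd x.x₃⟩) ∧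
      (a = -1 → b = -k → Nonempty
        (SkewBrace.Bab g hg k a b ≃* Multiplicative ((ZMod p × ZMod p) × ZMod q))) ∧
      (a = -1 → b ≠ -k → Nonempty (SkewBrace.Bab g hg k a b ≃* SkewBrace.GK g hg 0)) ∧
      (a ≠ -1 → Nonempty
        (SkewBrace.Bab g hg k a b ≃* SkewBrace.GK g hg ((b + k) / (a + 1)))) ∧
      SkewBrace.IsOfType (SkewBrace.Bab g hg k a b) (SkewBrace.GK g hg k) ∧
      Nat.card (SkewBrace.lam (SkewBrace.Bab g hg k a b)).ker = p ^ 2 ∧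
      SkewBrace.IsBiSkew (SkewBrace.Bab g hg k a b)) ∧
    -- they are pairwise non-isomorphic
    (∀ a b c d : ZMod q, (a, b) ≠ (0, 0) → (c, d) ≠ (0, 0) →
      Nonempty (SkewBrace.Bab g hg k a b ≃+* SkewBrace.Bab g hg k c d) → (a, b) = (c, d)) ∧
    -- every skew brace of `𝒢_k`-type with `|ker λ| = p²` is one of them
    (∀ (B : Type u) [SkewBrace B], SkewBrace.IsOfType B (SkewBrace.GK g hg k) →
      Nat.card (SkewBrace.lam B).ker = p ^ 2 →
      (∃ a b : ZMod q, (a, b) ≠ (0, 0) ∧ Nonempty (B ≃+* SkewBrace.Bab g hg k a b)) ∧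
      SkewBrace.IsBiSkew B) ∧
    -- there are `q² - 1` of them up to isomorphism
    SkewBrace.numIsoClasses (SkewBrace.GK g hg k) (p ^ 2) = q ^ 2 - 1 := by
  refine ⟨fun a b hab => ⟨fun _ _ => rfl, fun _ _ => rfl,
    ⟨SkewBrace.Bab.addEquivGK g hg k a b, fun _ => rfl⟩,
    ⟨SkewBrace.Bab.mulEquivDiagProd g hg k a b (a + 1) (b + k) 1 one_ne_zero (mul_one _).symm
      (mul_one _).symm, fun x => ?_⟩,
    fun ha hb => ⟨SkewBrace.Bab.mulEquivProd g hg k a b ha hb⟩,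
    fun ha hb => ⟨SkewBrace.Bab.mulEquivGKZero g hg k a b ha hb⟩, fun ha => ?_,
    SkewBrace.Bab.isOfType, SkewBrace.Bab.natCard_ker_lam hab, SkewBrace.Bab.isBiSkew⟩,
    fun a b c d _ _ ⟨φ⟩ => ?_, fun B _ hB hker => ?_,
    SkewBrace.numIsoClasses_GK hpq hk hk'⟩
  · simp [SkewBrace.Bab.mulEquivDiagProd]
  · have ha' : a + 1 ≠ 0 := fun h => ha (eq_neg_of_add_eq_zero_left h)
    exact ⟨SkewBrace.Bab.mulEquivDiagProd g hg k a b 1 ((b + k) / (a + 1)) (a + 1) ha'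
      (one_mul _).symm (div_mul_cancel₀ _ ha').symm⟩
  · exact Prod.ext_iff.2 (SkewBrace.Bab.eq_of_ringEquiv hpq hk hk' φ)
  · obtain ⟨a, b, hab, ⟨φ⟩⟩ := SkewBrace.exists_ringEquiv_Bab hpq hk hk' hB hker
    exact ⟨⟨a, b, hab, ⟨φ⟩⟩, SkewBrace.IsBiSkew.of_ringEquiv φ SkewBrace.Bab.isBiSkew⟩
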